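/- **Setting.** A *generalized category* is a partially ordered set $(\mathcal C,\le)$ of elements with source and target maps $f\mapsto\bar f,\ f\mapsto\hat f$ from $\mathcal C$ to itself and a partial composition, $a\cdot b$ being defined iff $\bar a\le\hat b$. Composition is associative, with $\overline{a\cdot b}=\bar b$ and $\widehat{a\cdot b}=\hat a$. Every element $a$ has an identity $1_a$ with source and target $a$. Objects (elements with $\bar a=\hat a=a$) act as identities. Source, target, composition and identities are monotone. Write $f:a\to b$ if $\bar f=a$ and $\hat f=b$. A *bipartite* generalized category $\mathcal E$ over $\mathcal C$ is a generalized category containing $\mathcal C$ as a subcategory such that $\hat\rho\in\mathcal C$ implies $\rho\in\mathcal C$. Its *upper region* consists of the elements $P\notin\mathcal C$ with $\bar P\notin\mathcal C$; such $P$ are called *generalized presheaves*. Arrows between generalized presheaves are elements of $\mathcal E$ whose source and target lie in the upper region. A *section* of $P$ over $U\in\mathcal C$ is an element $s:U\to P$. The sections of $P$ form a presheaf of sets on $\mathcal C$ by composition with elements $f:V\to U$ of $\mathcal C$. $\mathcal E=\mathrm{PSh}(\mathcal C)$ means that $\mathcal E$ is an *ideal maximal* bipartite generalized category over $\mathcal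 C$ (relative to a fixed universe containing $\mathcal C$). That is, each generalized presheaf $P$ has small sets of sections and an ideal section $s_U^P$ over every $U\in\mathcal C$, with $s_U^P\cdot f=s_V^P$ for $f:V\to U$ in $\mathcal C$ and $g\cdot s_U^P=s_U^Q$ for $g:P\to Q$. Every small presheaf of sets on $\mathcal C$ with ideal sections stable under restriction is isomorphic, preserving ideal sections, to the presheaf of sections of some generalized presheaf that is an object of $\mathcal E$. Every natural map from the sections of $P$ to those of $Q$ preserving ideal sections is composition with exactly one element $P\to Q$. A *sieve* at $U\in\mathcal C$ is a set of elements of $\mathcal C$ with target $U$ closed under right composition in $\mathcal C$. For a sieve $S$ at $U$ and $f:V\to U$ in $\mathcal C$, put $S/f=\{\sigma\in\mathcal C\mid\hat\sigma=V,\ f\cdot\sigma\in S\}$, a sieve at $V$. A *Grothendieck topology* $J$ on $\mathcal C$ assigns to each $U\in\mathcal C$ a collection of (covering) sieves at $U$, such that: the maximal sieve covers; if $S$ covers $U$ and $f:V\to U$, then $S/f$ covers $V$; if $S$ covers $U$ and $R$ is a sieve at $U$ such that $R/f$ covers $\bar f$ for all $f\in S$, then $R$ covers $U$. A generalized presheaf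 $P$ is a *$J$-sheaf* if for every sieve $S$ covering some $U$, every family $(x_f)_{f\in S}$ of sections $x_f$ of $P$ over $\bar f$ with $x_f\cdot\sigma=x_{f\cdot\sigma}$ has a unique section $s$ of $P$ over $U$ with $s\cdot f=x_f$ for all $f\in S$. Terminal object, monics, products and subobject classifiers are those of the category of generalized presheaves and the arrows between them. Let $\top:1\to\Omega$ be a subobject classifier with $1$ and $\Omega$ objects of $\mathcal E$ and $1$ terminal. Let $\mathrm{pred}(m):B\to\Omega$ be the predicate classifying a monic $m:A\to B$. Fix a product $\Omega\wedge\Omega$ and let $\delta=\mathrm{pred}(\langle\top,\top\rangle):\Omega\wedge\Omega\to\Omega$. A *Lawvere–Tierney topology* on $\mathcal E$ is an element $j:\Omega\to\Omega$ with $j\cdot\top=\top$, $j\cdot j=j$ and $j\cdot\delta=\delta\cdot(j\wedge j)$. A monic $m:A\to B$ is *$j$-dense* if $j\cdot\mathrm{pred}(m)$ is the composite $B\to1\xrightarrow{\top}\Omega$. A generalized presheaf $P$ is a *$j$-sheaf* if for every $j$-dense monic $m:A\to B$ and every $f:A\to P$ there is a unique $g:B\to P$ with $g\cdot m=f$. A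 section $\theta$ of $\Omega$ over $U$ names the sieve $S_\theta$ at $U$ of all $f:V\to U$ in $\mathcal C$ such that $\theta\cdot f=\top\cdot t$ for a section $t$ of $1$ over $V$. **Theorem.** Let $\mathcal C$ be a generalized category and $\mathcal E=\mathrm{PSh}(\mathcal C)$. Then $\mathcal E$ has a subobject classifier and a product $\Omega\wedge\Omega$ as above. For any choice of these, there are mutually inverse bijections $J\mapsto j_J$ and $j\mapsto J_j$ between Grothendieck topologies on $\mathcal C$ and Lawvere–Tierney topologies on $\mathcal E$, such that: 1. For every $J$, every section $\theta$ of $\Omega$ over $U$ and every $f:V\to U$ in $\mathcal C$: $f\in S_{j_J\cdot\theta}$ iff $S_\theta/f$ covers $V$ for $J$. 2. For every $j$ and every sieve $R$ at $U$: $R$ covers $U$ for $J_j$ iff $R=S_\theta$ for some section $\theta$ of $\Omega$ over $U$ such that $S_{j\cdot\theta}$ is the maximal sieve at $U$. 3. For every $J$ and every generalized presheaf $P$: $P$ is a $J$-sheaf iff $P$ is a $j_J$-sheaf. 4. For every $j$ and every generalized presheaf $P$: $P$ is a $J_j$-sheaf iff $P$ is a $j$-sheaf. -/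

import Mathlib

open CategoryTheory CategoryTheory.Limits Opposite

universe u v w

-- Keep `⟶` on categories elaborating through `CategoryStruct.toQuiver`.
attribute [-instance] catToReflQuiver

/-! ### Generalized categories -/

/-- A generalized category: a partially ordered set of elements with source and target maps to
itself, and a composite `comp a b` (written `a · b`, "`a` after `b`") which is defined exactly when
`src a ≤ tgt b`.  Identities are unique, so they are recorded as an operation `one`. -/
class GenCat (C : Type u) extends PartialOrder C where
  src : C → C
  tgt : C → C
  comp : ∀ a b : C, src a ≤ tgt b → C
  src_comp : ∀ a b h, src (comp a b h) = src b
  tgt_comp : ∀ a b h, tgt (comp a b h) = tgt a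
  assoc : ∀ (a b c : C) (hab : src a ≤ tgt b) (hbc : src b ≤ tgt c),
    comp (comp a b hab) c ((src_comp a b hab).le.trans hbc) =
      comp a (comp b c hbc) (hab.trans (tgt_comp b c hbc).ge)
  one : C → C
  src_one : ∀ a, src (one a) = a
  tgt_one : ∀ a, tgt (one a) = a
  one_comp : ∀ a c h, comp (one a) c h = c
  comp_one : ∀ a c h, comp c (one a) h = c
  obj_comp : ∀ a, src a = a → tgt a = a → ∀ b h, comp a b h = b
  comp_obj : ∀ a, src a = a → tgt a = a → ∀ b h, comp b a h = b
  src_mono : ∀ a b, a ≤ b → src a ≤ src b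
  tgt_mono : ∀ a b, a ≤ b → tgt a ≤ tgt b
  comp_mono : ∀ a b c d hac hbd, a ≤ b → c ≤ d → comp a c hac ≤ comp b d hbd
  one_mono : ∀ a b, a ≤ b → one a ≤ one b

namespace GenCat

/-- An object is an element that is its own source and target. -/
def IsObject {C : Type u} [GenCat C] (a : C) : Prop := src a = a ∧ tgt a = a

/-- The identity axioms force the order of a generalized category to be discrete. -/
theorem eq_of_le {C : Type u} [GenCat C] {a b : C} (h : a ≤ b) : a = b := by
  have h' : src (one a) ≤ tgt (one b) := by rw [src_one, tgt_one]; exact h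
  have e : one b = one a := (one_comp a (one b) h').symm.trans (comp_one b (one a) h')
  have := congrArg src e
  rw [src_one, src_one] at this
  exact this.symm

end GenCat

/-- A functor between generalized categories. -/
structure GenFunctor (C : Type u) (D : Type v) [GenCat C] [GenCat D] where
  toFun : C → D
  mono : ∀ a b, a ≤ b → toFun a ≤ toFun b
  map_src : ∀ a, toFun (GenCat.src a) = GenCat.src (toFun a)
  map_tgt : ∀ a, toFun (GenCat.tgt a) = GenCat.tgt (toFun a)
  map_comp : ∀ (a b : C) (h : GenCat.src a ≤ GenCat.tgt b),
    toFun (GenCat.comp a b h) = GenCat.comp (toFun a) (toFun b)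
      ((map_src a).ge.trans ((mono _ _ h).trans (map_tgt b).le))
  map_one : ∀ a, toFun (GenCat.one a) = GenCat.one (toFun a)

/-! ### Flattening

The hom sets `hom(a, b) = {f | src f = a, tgt f = b}` of a generalized category `C`, for all
elements `a, b` of `C`, with the composition of `C`, form an ordinary category. -/

/-- The type of elements of `C`, regarded as the objects of the flattening of `C`. -/
structure Flat (C : Type u) where
  el : C

/-- The hom sets: elements with prescribed source and target.
In Mathlib's notation `f ≫ g` is the composite `g · f`. -/
instance Flat.category (C : Type u) [GenCat C] : Category.{u} (Flat C) where
  Hom a b := {f : C // GenCat.src f = a.el ∧ GenCat.tgt f = b.el}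
  id a := ⟨GenCat.one a.el, GenCat.src_one _, GenCat.tgt_one _⟩
  comp f g := ⟨GenCat.comp g.1 f.1 (g.2.1.trans f.2.2.symm).le,
    (GenCat.src_comp _ _ _).trans f.2.1, (GenCat.tgt_comp _ _ _).trans g.2.2⟩
  id_comp _ := Subtype.ext (GenCat.comp_one _ _ _)
  comp_id _ := Subtype.ext (GenCat.one_comp _ _ _)
  assoc f g h := Subtype.ext
    (GenCat.assoc h.1 g.1 f.1 (h.2.1.trans g.2.2.symm).le (g.2.1.trans f.2.2.symm).le).symm

/-- The functor between flattenings that a functor of generalized categories induces. -/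
def GenFunctor.flat {C : Type u} {D : Type v} [GenCat C] [GenCat D] (F : GenFunctor C D) :
    Flat C ⥤ Flat D where
  obj a := ⟨F.toFun a.el⟩
  map f := ⟨F.toFun f.1, by rw [← F.map_src, f.2.1], by rw [← F.map_tgt, f.2.2]⟩
  map_id _ := Subtype.ext (F.map_one _)
  map_comp _ _ := Subtype.ext (F.map_comp _ _ _)

/-! ### Bipartite generalized categories -/

/-- A bipartite generalized category `E` over the base `C`: `C` is a subcategory of `E`, and every
element of `E` with target in `C` lies in `C`. -/
structure Bipartite (C : Type u) (E : Type v) [GenCat C] [GenCat E] where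
  incl : GenFunctor C E
  injective : Function.Injective incl.toFun
  mem_base : ∀ ρ : E, GenCat.tgt ρ ∈ Set.range incl.toFun → ρ ∈ Set.range incl.toFun

/-- The upper region: the elements that are neither in the base nor sections
(elements outside the base whose source is in the base). -/
def Bipartite.IsUpper {C : Type u} {E : Type v} [GenCat C] [GenCat E] (B : Bipartite C E)
    (P : E) : Prop :=
  P ∉ Set.range B.incl.toFun ∧ GenCat.src P ∉ Set.range B.incl.toFun

/-- The elements of the upper region, with the elements of `E` between them as morphisms. -/
abbrev Bipartite.Upper {C : Type u} {E : Type v} [GenCat C] [GenCat E] (B : Bipartite C E) :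
    Type v :=
  ObjectProperty.FullSubcategory (C := Flat E) (fun P => B.IsUpper P.el)

/-- The underlying element of an element of the upper region. -/
abbrev Bipartite.Upper.el {C : Type u} {E : Type v} [GenCat C] [GenCat E] {B : Bipartite C E}
    (P : B.Upper) : E := P.obj.el

/-- The pointed profunctor over the base given by an element `P` of the upper region:
its fiber over `U` is the set `hom(U, P)` of sections of `P` over `U`, and a base element
`f : V → U` sends a section `s` over `U` to the section `s · f` over `V`.
An element `P → Q` of `E` acts on sections by composition. -/
def Bipartite.fib {C : Type u} {E : Type v} [GenCat C] [GenCat E] (B : Bipartite C E) :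
    B.Upper ⥤ (Flat C)ᵒᵖ ⥤ Type v :=
  ObjectProperty.ι _ ⋙ yoneda ⋙ (Functor.whiskeringLeft _ _ _).obj B.incl.flat.op

/-- A pointed profunctor over `C`, given by its fibers and the action of `C` on sections, together
with an ideal section in each fiber, such that the ideal sections are stable under the action. -/
structure IdealProfunctor (C : Type u) [GenCat C] where
  Fib : (Flat C)ᵒᵖ ⥤ Type w
  ideal : ∀ U : Flat C, Fib.obj (op U)
  map_ideal : ∀ {V U : Flat C} (f : V ⟶ U), Fib.map f.op (ideal U) = ideal V

/-- `E` is a generalized category of generalized presheaves over `C`, that is, an ideal maximal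
bipartite generalized category over `C`.  Generalized presheaves are the elements of the upper
region.  Fibers are small relative to the universe of `C`. -/
structure GenPresheafCat (C : Type u) (E : Type v) [GenCat C] [GenCat E]
    extends Bipartite C E where
  small : ∀ (P : toBipartite.Upper) (U : Flat C), Small.{u} ((toBipartite.fib.obj P).obj (op U))
  /-- the ideal section of each generalized presheaf over each base element -/
  ideal : ∀ (P : toBipartite.Upper) (U : Flat C), (toBipartite.fib.obj P).obj (op U)
  /-- `s_U · f = s_V` for `f : V → U` in the base -/
  ideal_restrict : ∀ (P : toBipartite.Upper) {V U : Flat C} (f : V ⟶ U),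
    (toBipartite.fib.obj P).map f.op (ideal P U) = ideal P V
  /-- `g · s_U = s_U` for `g : P → Q` in the upper region -/
  comp_ideal : ∀ {P Q : toBipartite.Upper} (g : P ⟶ Q) (U : Flat C),
    (toBipartite.fib.map g).app (op U) (ideal P U) = ideal Q U
  /-- maximality: every pointed profunctor (with ideal sections) over `C` is the one given by some
  element of the upper region, which may be taken to be an object -/
  exists_presheaf : ∀ A : IdealProfunctor.{u, u} C, ∃ P : toBipartite.Upper,
    GenCat.IsObject P.el ∧
      ∃ e : ∀ U : Flat C, (toBipartite.fib.obj P).obj (op U) ≃ A.Fib.obj (op U),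
        (∀ U, e U (ideal P U) = A.ideal U) ∧
        ∀ (V U : Flat C) (f : V ⟶ U) (s : (toBipartite.fib.obj P).obj (op U)),
          e V ((toBipartite.fib.obj P).map f.op s) = A.Fib.map f.op (e U s)
  /-- maximality: every base-preserving morphism (preserving ideal sections) between the pointed
  profunctors of `P` and `Q` is given by an element `P → Q`, and by only one -/
  exists_hom : ∀ (P Q : toBipartite.Upper)
    (φ : toBipartite.fib.obj P ⟶ toBipartite.fib.obj Q),
    (∀ U : Flat C, φ.app (op U) (ideal P U) = ideal Q U) →
      ∃! g : P ⟶ Q, toBipartite.fib.map g = φ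

namespace GenPresheafCat

variable {C : Type u} {E : Type v} [GenCat C] [GenCat E]

/-- The category of generalized presheaves (the upper region of `E`). -/
abbrev Psh (S : GenPresheafCat C E) : Type v := S.toBipartite.Upper

/-- The sections of a generalized presheaf, as a presheaf of sets on the elements of `C`. -/
abbrev sections (S : GenPresheafCat C E) (P : S.Psh) : (Flat C)ᵒᵖ ⥤ Type v :=
  S.toBipartite.fib.obj P

/-- A subobject classifier `true : 1 → Ω` of the category of generalized presheaves, where `1`
and `Ω` are objects of `E`, together with a chosen product `Ω ∧ Ω`. -/
structure SubobjectClassifier (S : GenPresheafCat C E) where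
  one : S.Psh
  one_isObject : GenCat.IsObject one.el
  isTerminal : IsTerminal one
  Ω : S.Psh
  Ω_isObject : GenCat.IsObject Ω.el
  tru : one ⟶ Ω
  /-- the predicate (characteristic function) of a monic -/
  pred : ∀ {A B : S.Psh} (m : A ⟶ B) [Mono m], B ⟶ Ω
  isPullback : ∀ {A B : S.Psh} (m : A ⟶ B) [Mono m],
    IsPullback m (isTerminal.from A) (pred m) tru
  pred_unique : ∀ {A B : S.Psh} (m : A ⟶ B) [Mono m] (p : B ⟶ Ω),
    IsPullback m (isTerminal.from A) p tru → p = pred m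
  ΩΩ : S.Psh
  fst : ΩΩ ⟶ Ω
  snd : ΩΩ ⟶ Ω
  isProduct : IsLimit (BinaryFan.mk fst snd)

namespace SubobjectClassifier

variable {S : GenPresheafCat C E} (K : S.SubobjectClassifier)

/-- The pairing `⟨f, g⟩ : A → Ω ∧ Ω`. -/
noncomputable def pair {A : S.Psh} (f g : A ⟶ K.Ω) : A ⟶ K.ΩΩ :=
  K.isProduct.lift (BinaryFan.mk f g)

/-- The predicate `true_A` on `A`, that is `true` after the terminal arrow of `A`. -/
def truAt (A : S.Psh) : A ⟶ K.Ω := K.isTerminal.from A ≫ K.tru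

/-- The meet operation `Ω ∧ Ω → Ω`: the predicate of the monic `⟨true, true⟩ : 1 → Ω ∧ Ω`. -/
noncomputable def meet : K.ΩΩ ⟶ K.Ω :=
  letI : Mono (K.pair K.tru K.tru) := K.isTerminal.mono_from _
  K.pred (K.pair K.tru K.tru)

/-- A Lawvere–Tierney topology. -/
structure LTTopology where
  j : K.Ω ⟶ K.Ω
  tru_j : K.tru ≫ j = K.tru
  j_j : j ≫ j = j
  meet_j : K.meet ≫ j = K.pair (K.fst ≫ j) (K.snd ≫ j) ≫ K.meet

variable {K}

/-- A monic is dense if its closure, the subobject with predicate `j · pred m`, is everything. -/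
def LTTopology.IsDense (L : K.LTTopology) {A B : S.Psh} (m : A ⟶ B) [Mono m] : Prop :=
  K.pred m ≫ L.j = K.truAt B

/-- `P` is a sheaf for `j`: arrows to `P` extend uniquely along dense monics. -/
def LTTopology.IsSheaf (L : K.LTTopology) (P : S.Psh) : Prop :=
  ∀ ⦃A B : S.Psh⦄ (m : A ⟶ B) [Mono m], L.IsDense m →
    ∀ f : A ⟶ P, ∃! g : B ⟶ P, m ≫ g = f

variable (K)

/-- The sieve at `U` named by a section `θ : U → Ω`: the base elements `f : V → U` such that
`θ · f` is the true section of `Ω` over `V`. -/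
def sieve {U : Flat C} (θ : (S.sections K.Ω).obj (op U)) : Sieve U where
  arrows V f := ∃ t : (S.sections K.one).obj (op V),
    (S.toBipartite.fib.map K.tru).app (op V) t = (S.sections K.Ω).map f.op θ
  downward_closed := by
    rintro V W f ⟨t, ht⟩ g
    refine ⟨(S.sections K.one).map g.op t, ?_⟩
    have h := congrArg (fun k => k t) ((S.toBipartite.fib.map K.tru).naturality g.op)
    simp only [types_comp_apply] at h
    refine h.trans ?_
    rw [ht, op_comp, Functor.map_comp]
    rfl

end SubobjectClassifier

/-- `P` is a generalized sheaf for a Grothendieck topology `J` on `C`: for every covering sieve,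
every matching family of sections of `P` has a unique amalgamation. -/
def IsSheaf (S : GenPresheafCat C E) (J : GrothendieckTopology (Flat C)) (P : S.Psh) : Prop :=
  Presieve.IsSheaf J (S.sections P)

end GenPresheafCat

/-! ### Existence

Every generalized category `C` has a generalized category of generalized presheaves.  Its upper
elements are the objects `obj P`, one for each pointed profunctor `P` with ideal sections, and, for
the remaining sections, morphisms and identities, freely added elements `ar x y φ` (whose own
fibers are one-point sets). -/
namespace Witness

section General

variable {X : Type w} [Category.{u} X] (e : (Σ x y : X, x ⟶ y) ≃ X)

def sr (a : X) : X := (e.symm a).1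
def tg (a : X) : X := (e.symm a).2.1

lemma sr_mk {x y : X} (f : x ⟶ y) : sr e (e ⟨x, y, f⟩) = x :=
  congrArg (fun s => s.1) (e.symm_apply_apply _)
lemma tg_mk {x y : X} (f : x ⟶ y) : tg e (e ⟨x, y, f⟩) = y :=
  congrArg (fun s => s.2.1) (e.symm_apply_apply _)

def comp' (a b : X) (h : sr e a = tg e b) : X :=
  e ⟨sr e b, tg e a, (e.symm b).2.2 ≫ eqToHom h.symm ≫ (e.symm a).2.2⟩

lemma comp'_mk {x y z : X} (f : x ⟶ y) (g : y ⟶ z) (h) :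
    comp' e (e ⟨y, z, g⟩) (e ⟨x, y, f⟩) h = e ⟨x, z, f ≫ g⟩ := by
  have : ∀ (s t : Σ x y : X, x ⟶ y) (hs : s = ⟨y, z, g⟩) (ht : t = ⟨x, y, f⟩) (h : s.1 = t.2.1),
      (⟨t.1, s.2.1, t.2.2 ≫ eqToHom h.symm ≫ s.2.2⟩ : Σ x y : X, x ⟶ y) = ⟨x, z, f ≫ g⟩ := by
    rintro _ _ rfl rfl h; simp
  exact congrArg e (this _ _ (e.symm_apply_apply _) (e.symm_apply_apply _) h)

lemma mk_surj (a : X) : ∃ (x y : X) (f : x ⟶ y), a = e ⟨x, y, f⟩ :=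
  ⟨_, _, (e.symm a).2.2, (e.apply_symm_apply a).symm⟩

lemma id_comp' (a c : X) (h) : comp' e (e ⟨a, a, 𝟙 a⟩) c h = c := by
  obtain ⟨x, y, f, rfl⟩ := mk_surj e c
  obtain rfl : a = y := by rw [← sr_mk e (𝟙 a), h, tg_mk]
  rw [comp'_mk, Category.comp_id]

lemma comp_id' (a c : X) (h) : comp' e c (e ⟨a, a, 𝟙 a⟩) h = c := by
  obtain ⟨x, y, f, rfl⟩ := mk_surj e c
  obtain rfl : x = a := by rw [← tg_mk e (𝟙 a), ← h, sr_mk]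
  rw [comp'_mk, Category.id_comp]

@[reducible] def discreteOrder (X : Type w) : PartialOrder X where
  le a b := a = b
  le_refl _ := rfl
  le_trans _ _ _ := Eq.trans
  le_antisymm _ _ h _ := h

lemma obj_eq (he : ∀ (x : X) (f : x ⟶ x), e ⟨x, x, f⟩ = x → f = 𝟙 x) (a : X)
    (h1 : sr e a = a) (h2 : tg e a = a) : a = e ⟨a, a, 𝟙 a⟩ := by
  have key : ∀ (x y : X) (f : x ⟶ y), a = e ⟨x, y, f⟩ → a = x → a = y → a = e ⟨a, a, 𝟙 a⟩ := by
    rintro x y f hf rfl rfl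
    rw [he _ f hf.symm] at hf
    exact hf
  exact key _ _ (e.symm a).2.2 (e.apply_symm_apply a).symm h1.symm h2.symm

@[reducible] def genCat (he : ∀ (x : X) (f : x ⟶ x), e ⟨x, x, f⟩ = x → f = 𝟙 x) : GenCat X where
  toPartialOrder := discreteOrder X
  src := sr e
  tgt := tg e
  comp a b h := comp' e a b h
  src_comp a b h := sr_mk e _
  tgt_comp a b h := tg_mk e _
  assoc a b c hab hbc := by
    obtain ⟨x, y, f, rfl⟩ := mk_surj e a
    obtain ⟨x', y', g, rfl⟩ := mk_surj e b
    obtain ⟨x'', y'', k, rfl⟩ := mk_surj e c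
    obtain rfl : x = y' := (sr_mk e f).symm.trans (Eq.trans hab (tg_mk e g))
    obtain rfl : x' = y'' := (sr_mk e g).symm.trans (Eq.trans hbc (tg_mk e k))
    simp only [comp'_mk, Category.assoc]
  one a := e ⟨a, a, 𝟙 a⟩
  src_one a := sr_mk e _
  tgt_one a := tg_mk e _
  one_comp a c h := id_comp' e a c h
  comp_one a c h := comp_id' e a c h
  obj_comp a h1 h2 b h := by
    have k := obj_eq e he a h1 h2
    have : ∀ a' (h : sr e a' = tg e b), a' = e ⟨a, a, 𝟙 a⟩ → comp' e a' b h = b := by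
      rintro _ h rfl; exact id_comp' e a b h
    exact this a h k
  comp_obj a h1 h2 b h := by
    have k := obj_eq e he a h1 h2
    have : ∀ a' (h : sr e b = tg e a'), a' = e ⟨a, a, 𝟙 a⟩ → comp' e b a' h = b := by
      rintro _ h rfl; exact comp_id' e a b h
    exact this a h k
  src_mono a b h := congrArg (sr e) h
  tgt_mono a b h := congrArg (tg e) h
  comp_mono a b c d hac hbd h1 h2 := by cases h1; cases h2; rfl
  one_mono a b h := by cases h; rfl

end General

variable (C : Type u) [GenCat C]

inductive Node : Type (u + 1)
  | base (c : C)
  | psh (P : IdealProfunctor.{u, u} C)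

variable {C}

def Node.Hom : Node C → Node C → Type u
  | .base a, .base b => (Flat.mk a) ⟶ (Flat.mk b)
  | .base a, .psh P => P.Fib.obj (op ⟨a⟩)
  | .psh _, .base _ => PEmpty
  | .psh P, .psh Q => {φ : P.Fib ⟶ Q.Fib // ∀ U, φ.app (op U) (P.ideal U) = Q.ideal U}

instance : Category.{u} (Node C) where
  Hom := Node.Hom
  id
    | .base a => 𝟙 (Flat.mk a)
    | .psh P => ⟨𝟙 P.Fib, fun _ => rfl⟩
  comp {p q r} f g := match p, q, r, f, g with
    | .base a, .base b, .base c, f, g => ((f : Flat.mk a ⟶ Flat.mk b) ≫ (g : Flat.mk b ⟶ Flat.mk c))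
    | .base a, .base b, .psh P, f, g => P.Fib.map (Quiver.Hom.op (f : Flat.mk a ⟶ Flat.mk b)) g
    | .base a, .psh P, .psh Q, f, g => (g.1.app (op ⟨a⟩)) f
    | .psh P, .psh Q, .psh R, f, g => ⟨f.1 ≫ g.1, fun U => by
        have h1 := f.2 U
        have h2 := g.2 U
        rw [← h2, ← h1]; rfl⟩
  id_comp {p q} f := by
    cases p <;> cases q
    · exact Category.id_comp _
    · rename_i a P
      exact congrArg (fun k => k f) (P.Fib.map_id (op ⟨a⟩))
    · exact f.elim
    · exact Subtype.ext (Category.id_comp _)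
  comp_id {p q} f := by
    cases p <;> cases q
    · exact Category.comp_id _
    · rfl
    · exact f.elim
    · exact Subtype.ext (Category.comp_id _)
  assoc {p q r s} f g h := by
    cases p <;> cases q <;> cases r <;> cases s <;> first
      | exact f.elim
      | exact g.elim
      | exact h.elim
      | skip
    · exact Category.assoc _ _ _
    · rename_i a b c P
      exact congrArg (fun k => k h) (P.Fib.map_comp
        (Quiver.Hom.op (g : Flat.mk b ⟶ Flat.mk c)) (Quiver.Hom.op (f : Flat.mk a ⟶ Flat.mk b)))
    · rename_i a b P Q
      exact congrArg (fun k => k g)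
        (h.1.naturality (Quiver.Hom.op (f : Flat.mk a ⟶ Flat.mk b)))
    · rfl
    · exact Subtype.ext (Category.assoc _ _ _)

variable (C) in
def pt : IdealProfunctor.{u, u} C where
  Fib := (Functor.const _).obj PUnit
  ideal _ := PUnit.unit
  map_ideal _ := rfl

inductive Tree : Node C → Bool → Type (u + 1)
  | base (c : C) : Tree (.base c) true
  | obj (P : IdealProfunctor.{u, u} C) : Tree (.psh P) true
  | ar {p : Node C} {b : Bool} (x : Tree p b) {Q : IdealProfunctor.{u, u} C} {b' : Bool}
      (y : Tree (.psh Q) b') (φ : p ⟶ .psh Q)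
      (h : ¬ (b = true ∧ b' = true ∧ ∃ e : p = .psh Q, φ = eqToHom e)) : Tree (.psh (pt C)) false

variable (C) in
structure El : Type (u + 1) where
  node : Node C
  flag : Bool
  tree : Tree node flag

instance : Category.{u} (El C) := inferInstanceAs (Category (InducedCategory (Node C) El.node))

abbrev bs (c : C) : El C := ⟨_, _, .base c⟩

def hm {x y : El C} (f : x.node ⟶ y.node) : x ⟶ y := InducedCategory.homMk f

def arrow : El C → Σ x y : El C, x ⟶ y
  | ⟨_, _, .base c⟩ => ⟨bs (GenCat.src c), bs (GenCat.tgt c),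
      hm (show Node.Hom (.base _) (.base _) from ⟨c, rfl, rfl⟩)⟩
  | ⟨_, _, .obj P⟩ => ⟨⟨_, _, .obj P⟩, ⟨_, _, .obj P⟩, 𝟙 _⟩
  | ⟨_, _, .ar x y φ _⟩ => ⟨⟨_, _, x⟩, ⟨_, _, y⟩, hm φ⟩


def depth {p : Node C} {b : Bool} : Tree p b → ℕ
  | .base _ => 0
  | .obj _ => 0
  | .ar x _ _ _ => depth x + 1

lemma bs_inj {a b : C} (h : bs a = bs b) : a = b := by
  have := congrArg El.node h
  simpa using this

lemma arrow_inj : Function.Injective (arrow (C := C)) := by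
  rintro ⟨_, _, t⟩ ⟨_, _, t'⟩ h
  have hs := congrArg (fun s => s.1) h
  have ht := congrArg (fun s => s.2.1) h
  cases t with
  | base c =>
    cases t' with
    | base c' =>
      have hs : bs (GenCat.src c) = bs (GenCat.src c') := hs
      have ht : bs (GenCat.tgt c) = bs (GenCat.tgt c') := ht
      have key : ∀ a b a' b' (f : Flat.mk a ⟶ Flat.mk b) (f' : Flat.mk a' ⟶ Flat.mk b'),
        a = a' → b = b' →
        (⟨bs a, bs b, hm (show Node.Hom (.base _) (.base _) from f)⟩ : Σ x y : El C, x ⟶ y)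
          = ⟨bs a', bs b', hm (show Node.Hom (.base _) (.base _) from f')⟩ → f.1 = f'.1 := by
        rintro a b _ _ f f' rfl rfl h
        have h := eq_of_heq (Sigma.mk.inj (eq_of_heq (Sigma.mk.inj h).2)).2
        have h := congrArg InducedCategory.Hom.hom h
        exact congrArg Subtype.val h
      have h := key _ _ _ _ _ _ (bs_inj hs) (bs_inj ht) h
      have h : c = c' := h
      rw [h]
    | obj P => simp [arrow] at hs
    | ar x y φ k =>
      have := congrArg El.node ht
      simp [arrow] at this
  | obj P =>
    cases t' with
    | base c' => simp [arrow] at hs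
    | obj P' =>
      have := congrArg El.node hs
      simp [arrow] at this
      rw [this]
    | ar x y φ k =>
      exfalso; apply k
      simp only [arrow] at h
      cases hs; cases ht
      have h := eq_of_heq (Sigma.mk.inj (eq_of_heq (Sigma.mk.inj h).2)).2
      have h := congrArg InducedCategory.Hom.hom h
      exact ⟨rfl, rfl, rfl, h.symm⟩
  | ar x y φ k =>
    cases t' with
    | base c' =>
      have := congrArg El.node ht
      simp [arrow] at this
    | obj P =>
      exfalso; apply k
      simp only [arrow] at h
      cases hs; cases ht
      have h := eq_of_heq (Sigma.mk.inj (eq_of_heq (Sigma.mk.inj h).2)).2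
      have h := congrArg InducedCategory.Hom.hom h
      exact ⟨rfl, rfl, rfl, h⟩
    | ar x' y' φ' k' =>
      cases hs; cases ht
      have h := eq_of_heq (Sigma.mk.inj (eq_of_heq (Sigma.mk.inj h).2)).2
      have h := congrArg InducedCategory.Hom.hom h
      have h : φ = φ' := h
      subst h; rfl

lemma arrow_surj : Function.Surjective (arrow (C := C)) := by
  rintro ⟨⟨p, b, x⟩, ⟨q, b', y⟩, ⟨φ⟩⟩
  change p ⟶ q at φ
  cases q with
  | base c =>
    cases y
    cases x with
    | base c' =>
      obtain ⟨f, h1, h2⟩ := φ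
      simp only at h1 h2
      subst h1 h2
      exact ⟨⟨_, _, .base f⟩, rfl⟩
    | obj P => exact φ.elim
    | ar _ _ _ _ => exact φ.elim
  | psh Q =>
    by_cases h : ¬ (b = true ∧ b' = true ∧ ∃ e : p = Node.psh Q, φ = eqToHom e)
    · exact ⟨⟨_, _, .ar x y φ h⟩, rfl⟩
    · push Not at h
      obtain ⟨h1, h2, e, h3⟩ := h
      subst e
      subst h1 h2 h3
      cases x; cases y
      exact ⟨⟨_, _, .obj Q⟩, rfl⟩

variable (C) in
noncomputable def eqv : (Σ x y : El C, x ⟶ y) ≃ El C :=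
  (Equiv.ofBijective arrow ⟨arrow_inj, arrow_surj⟩).symm

lemma eqv_symm (a : El C) : (eqv C).symm a = arrow a := rfl

lemma eqv_id (x : El C) (f : x ⟶ x) (h : eqv C ⟨x, x, f⟩ = x) : f = 𝟙 x := by
  have h : (⟨x, x, f⟩ : Σ x y : El C, x ⟶ y) = arrow x := by
    exact (eqv C).eq_symm_apply.2 h
  obtain ⟨_, _, x⟩ := x
  cases x with
  | base c =>
    have hs := congrArg (fun s => s.1) h
    have ht := congrArg (fun s => s.2.1) h
    have hs := bs_inj hs
    have ht := bs_inj ht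
    have key : ∀ a b (g : Flat.mk a ⟶ Flat.mk b), a = c → b = c → Subtype.val g = GenCat.one c →
        (⟨bs c, bs c, f⟩ : Σ x y : El C, x ⟶ y) =
        ⟨bs a, bs b, hm (show Node.Hom (.base _) (.base _) from g)⟩ → f = 𝟙 _ := by
      rintro _ _ g rfl rfl hg h
      have h := eq_of_heq (Sigma.mk.inj (eq_of_heq (Sigma.mk.inj h).2)).2
      rw [h]
      have : g = 𝟙 _ := Subtype.ext hg
      rw [this]
      rfl
    refine key _ _ _ hs.symm ht.symm ?_ h
    have h1 : GenCat.src c ≤ GenCat.tgt (GenCat.one c) := by rw [GenCat.tgt_one, ← hs]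
    exact (GenCat.comp_one c c h1).symm.trans (GenCat.obj_comp c hs.symm ht.symm _ h1)
  | obj P => exact eq_of_heq (Sigma.mk.inj (eq_of_heq (Sigma.mk.inj h).2)).2
  | ar x y φ k =>
    have hs := congrArg (fun s => depth s.1.tree) h
    simp [arrow, depth] at hs

noncomputable instance : GenCat (El C) := genCat (eqv C) eqv_id

/-- Elements with given source and target are the arrows of the node category. -/
noncomputable def toFlat : El C ⥤ Flat (El C) where
  obj x := ⟨x⟩
  map {x y} f := ⟨eqv C ⟨x, y, f⟩, sr_mk _ _, tg_mk _ _⟩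
  map_id x := rfl
  map_comp f g := Subtype.ext (comp'_mk _ _ _ (by rw [sr_mk, tg_mk])).symm

instance : (toFlat (C := C)).Full where
  map_surjective {x y} f := by
    obtain ⟨f, h1, h2⟩ := f
    obtain ⟨a, b, g, rfl⟩ := mk_surj (eqv C) f
    obtain rfl : a = x := (sr_mk (eqv C) g).symm.trans h1
    obtain rfl : b = y := (tg_mk (eqv C) g).symm.trans h2
    exact ⟨g, rfl⟩

instance : (toFlat (C := C)).Faithful where
  map_injective {x y} f g h := by
    have h : eqv C ⟨x, y, f⟩ = eqv C ⟨x, y, g⟩ := congrArg (fun k : (toFlat.obj x ⟶ toFlat.obj y) => k.1) h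
    have h := (eqv C).injective h
    exact eq_of_heq (Sigma.mk.inj (eq_of_heq (Sigma.mk.inj h).2)).2

lemma eqv_base {a b : C} (f : Flat.mk a ⟶ Flat.mk b) :
    eqv C ⟨bs a, bs b, hm (show Node.Hom (.base _) (.base _) from f)⟩ = bs f.1 := by
  obtain ⟨f, h1, h2⟩ := f
  simp only at h1 h2
  subst h1 h2
  exact (eqv C).apply_symm_apply (bs f)

variable (C) in
noncomputable def bip : Bipartite C (El C) where
  incl :=
    { toFun := bs
      mono := fun a b h => by rw [GenCat.eq_of_le h]
      map_src := fun a => rfl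
      map_tgt := fun a => rfl
      map_comp := fun a b h => by
        have h := GenCat.eq_of_le h
        let f' : Flat.mk (GenCat.src b) ⟶ Flat.mk (GenCat.src a) := ⟨b, rfl, h.symm⟩
        let g' : Flat.mk (GenCat.src a) ⟶ Flat.mk (GenCat.tgt a) := ⟨a, rfl, rfl⟩
        have h1 := eqv_base (f' ≫ g')
        have h2 := comp'_mk (eqv C) (hm (x := bs _) (y := bs _) (show Node.Hom (.base _) (.base _) from f'))
          (hm (x := bs _) (y := bs _) (show Node.Hom (.base _) (.base _) from g')) (by rw [sr_mk, tg_mk])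
        refine h1.symm.trans (Eq.trans ?_ (h2.symm.trans ?_))
        · rfl
        · have : ∀ (a b a' b' : El C) h h', a = a' → b = b' →
            comp' (eqv C) a b h = comp' (eqv C) a' b' h' := by
            rintro _ _ _ _ _ _ rfl rfl; rfl
          exact this _ _ _ _ _ _ (eqv_base g') (eqv_base f')
      map_one := fun a => (eqv_base (𝟙 (Flat.mk a))).symm }
  injective a b h := bs_inj h
  mem_base ρ h := by
    obtain ⟨a, b, f, rfl⟩ := mk_surj (eqv C) ρ
    have : GenCat.tgt (eqv C ⟨a, b, f⟩) = b := tg_mk _ _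
    rw [this] at h
    obtain ⟨c, rfl⟩ := h
    obtain ⟨_, _, x⟩ := a
    obtain ⟨f⟩ := f
    cases x with
    | base c' => exact ⟨_, (eqv_base (show Flat.mk c' ⟶ Flat.mk c from f)).symm⟩
    | obj P => exact f.elim
    | ar _ _ _ _ => exact f.elim



noncomputable def pre (x y : El C) (f : Flat.mk x ⟶ Flat.mk y) : x ⟶ y :=
  toFlat.preimage (X := x) (Y := y) f

lemma map_pre (x y : El C) (f : Flat.mk x ⟶ Flat.mk y) : toFlat.map (pre x y f) = f :=
  toFlat.map_preimage (X := x) (Y := y) f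

lemma pre_map (x y : El C) (f : x ⟶ y) : pre x y (toFlat.map f) = f := toFlat.preimage_map f

lemma pre_id (x : El C) : pre x x (𝟙 (Flat.mk x)) = 𝟙 x :=
  toFlat.map_injective ((map_pre _ _ _).trans (toFlat.map_id x).symm)

lemma pre_comp (x y z : El C) (f : Flat.mk x ⟶ Flat.mk y) (g : Flat.mk y ⟶ Flat.mk z) :
    pre x z (f ≫ g) = pre x y f ≫ pre y z g :=
  toFlat.map_injective ((map_pre _ _ _).trans (by
    rw [toFlat.map_comp, map_pre, map_pre]; rfl))

noncomputable def nd : Flat (El C) ⥤ Node C where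
  obj x := x.el.node
  map {x y} f := (pre x.el y.el f).hom
  map_id x := congrArg InducedCategory.Hom.hom (pre_id x.el)
  map_comp {x y z} f g := congrArg InducedCategory.Hom.hom (pre_comp x.el y.el z.el f g)

lemma nd_toFlat {x y : El C} (f : x ⟶ y) : nd.map (toFlat.map f) = f.hom :=
  congrArg InducedCategory.Hom.hom (pre_map x y f)

instance : (nd (C := C)).Full where
  map_surjective {x y} f := ⟨toFlat.map (X := x.el) (Y := y.el) (hm f), nd_toFlat _⟩

instance : (nd (C := C)).Faithful where
  map_injective {x y} f g h := by
    have h : pre x.el y.el f = pre x.el y.el g := InducedCategory.hom_ext h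
    have h2 := congrArg toFlat.map h
    rwa [map_pre, map_pre] at h2

abbrev bn (U : Flat C) : Node C := .base U.el
def bh {U V : Flat C} (f : U ⟶ V) : bn U ⟶ bn V := f

lemma nd_base {U V : Flat C} (f : U ⟶ V) : nd.map ((bip C).incl.flat.map f) = bh f := by
  have : (bip C).incl.flat.map f = toFlat.map (X := bs U.el) (Y := bs V.el) (hm (bh f)) :=
    Subtype.ext (eqv_base f).symm
  rw [this]; exact nd_toFlat _

def IsB : Node C → Prop
  | .base _ => True
  | .psh _ => False

def idl : (p : Node C) → ¬ IsB p → (U : Flat C) → (bn U ⟶ p)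
  | .base _, h, _ => (h trivial).elim
  | .psh Q, _, U => Q.ideal U

lemma idl_restrict (p : Node C) (h) {U V : Flat C} (f : V ⟶ U) : bh f ≫ idl p h U = idl p h V := by
  cases p with
  | base c => exact (h trivial).elim
  | psh Q => exact Q.map_ideal f

lemma idl_comp (p q : Node C) (h h') (g : p ⟶ q) (U : Flat C) : idl p h U ≫ g = idl q h' U := by
  cases p with
  | base c => exact (h trivial).elim
  | psh P =>
  cases q with
  | base c => exact g.elim
  | psh Q => exact g.2 U

lemma node_hom (p q : Node C) (h h') (φ : ∀ U, (bn U ⟶ p) → (bn U ⟶ q))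
    (hn : ∀ {V U : Flat C} (f : V ⟶ U) s, φ V (bh f ≫ s) = bh f ≫ φ U s)
    (hi : ∀ U, φ U (idl p h U) = idl q h' U) : ∃! g : p ⟶ q, ∀ U s, s ≫ g = φ U s := by
  cases p with
  | base c => exact (h trivial).elim
  | psh P =>
  cases q with
  | base c => exact (h' trivial).elim
  | psh Q =>
    refine ⟨⟨{ app := fun U => ↾(fun s => φ U.unop s), naturality := ?_ }, hi⟩, fun U s => rfl, ?_⟩
    · intro U V f
      ext s
      exact hn f.unop s
    · intro g hg
      apply Subtype.ext
      ext U s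
      exact hg U.unop s

lemma upper_node (P : (bip C).Upper) : ¬ IsB (nd.obj P.obj) := by
  obtain ⟨⟨⟨p, b, x⟩⟩, h, -⟩ := P
  cases x with
  | base c => exact absurd ⟨c, rfl⟩ h
  | obj P => exact id
  | ar _ _ _ _ => exact id

lemma fib_map (P : (bip C).Upper) {U V : Flat C} (f : V ⟶ U)
    (s : ((bip C).fib.obj P).obj (op U)) :
    nd.map (((bip C).fib.obj P).map f.op s) = bh f ≫ nd.map s := by
  have h := nd.map_comp (X := ⟨bs V.el⟩) (Y := ⟨bs U.el⟩) (Z := P.obj) ((bip C).incl.flat.map f) s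
  exact h.trans (congrArg (fun k : bn V ⟶ bn U => k ≫ nd.map (X := ⟨bs U.el⟩) s) (nd_base f))

lemma fib_app {P Q : (bip C).Upper} (g : P ⟶ Q) (U : Flat C)
    (s : ((bip C).fib.obj P).obj (op U)) :
    nd.map (((bip C).fib.map g).app (op U) s) = nd.map s ≫ nd.map g.hom :=
  nd.map_comp _ _

noncomputable def secEquiv (P : (bip C).Upper) (U : Flat C) :
    ((bip C).fib.obj P).obj (op U) ≃ (bn U ⟶ nd.obj P.obj) :=
  Equiv.ofBijective (fun s => nd.map (X := ⟨bs U.el⟩) s) ⟨nd.map_injective, nd.map_surjective⟩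

lemma sec_restrict (P : (bip C).Upper) {U V : Flat C} (f : V ⟶ U)
    (s : ((bip C).fib.obj P).obj (op U)) :
    secEquiv P V (((bip C).fib.obj P).map f.op s) = bh f ≫ secEquiv P U s := fib_map P f s

lemma sec_app {P Q : (bip C).Upper} (g : P ⟶ Q) (U : Flat C)
    (s : ((bip C).fib.obj P).obj (op U)) :
    secEquiv Q U (((bip C).fib.map g).app (op U) s) = secEquiv P U s ≫ nd.map g.hom := fib_app g U s

variable (C) in
noncomputable def presheafCat : GenPresheafCat C (El C) where
  toBipartite := bip C
  small P U := small_of_injective (secEquiv P U).injective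
  ideal P U := (secEquiv P U).symm (idl _ (upper_node P) U)
  ideal_restrict P V U f := by
    apply (secEquiv P V).injective
    refine (sec_restrict P f _).trans ?_
    rw [Equiv.apply_symm_apply, Equiv.apply_symm_apply]
    exact idl_restrict _ _ f
  comp_ideal {P Q} g U := by
    apply (secEquiv Q U).injective
    refine (sec_app g U _).trans ?_
    rw [Equiv.apply_symm_apply, Equiv.apply_symm_apply]
    exact idl_comp _ _ _ _ _ U
  exists_presheaf A := by
    let a : El C := ⟨_, _, .obj A⟩
    have ha : a ∉ Set.range (bip C).incl.toFun := by
      rintro ⟨c, hc⟩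
      have := congrArg El.node hc
      cases this
    refine ⟨⟨⟨a⟩, ha, ha⟩, ⟨rfl, rfl⟩, fun U => secEquiv _ U, ?_, ?_⟩
    · intro U
      exact Equiv.apply_symm_apply _ _
    · intro V U f s
      exact sec_restrict _ f s
  exists_hom P Q φ hφ := by
    obtain ⟨g, hg, hu⟩ := node_hom _ _ (upper_node P) (upper_node Q)
      (fun U s => secEquiv Q U (φ.app (op U) ((secEquiv P U).symm s)))
      (by
        intro V U f s
        obtain ⟨s, rfl⟩ := (secEquiv P U).surjective s
        rw [Equiv.symm_apply_apply, ← sec_restrict, Equiv.symm_apply_apply, ← sec_restrict]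
        exact congrArg (fun k => secEquiv Q V (k s)) (φ.naturality f.op))
      (by
        intro U
        have := hφ U
        exact (congrArg (secEquiv Q U) this).trans (Equiv.apply_symm_apply _ _))
    obtain ⟨g, rfl⟩ := nd.map_surjective g
    refine ⟨⟨g⟩, ?_, ?_⟩
    · ext U s
      apply (secEquiv Q U.unop).injective
      have := hg U.unop (secEquiv P U.unop s)
      rw [Equiv.symm_apply_apply] at this
      exact (sec_app (P := P) (Q := Q) ⟨g⟩ U.unop s).trans this
    · intro k hk
      have := hu (nd.map k.hom) (by
        intro U s
        obtain ⟨s, rfl⟩ := (secEquiv P U).surjective s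
        rw [Equiv.symm_apply_apply, ← hk, sec_app])
      exact InducedCategory.hom_ext (nd.map_injective this)

end Witness

/-- Every generalized category has a generalized category of generalized presheaves. -/
theorem GenPresheafCat.exists (C : Type u) [GenCat C] :
    ∃ (E : Type (u + 1)) (_ : GenCat E), Nonempty (GenPresheafCat C E) :=
  ⟨_, _, ⟨Witness.presheafCat C⟩⟩

/-! Maximality says that generalized presheaves and their arrows behave exactly like presheaves of
sets on `Flat C` with a chosen point (the ideal section) stable under restriction, and natural maps
preserving it: arrows are determined by their action on sections (`hom_ext`), and every natural
pointed map occurs (`exists_act`). A sieve `R` at `U` with a disjoint point adjoined is realized by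
`hull R`. Arrows out of `hull R` are matching families for `R`, so `hull ⊤` represents sections over
`U` (`exists_rep`, `rep_ext`). Hence monics are injective on sections, and terminal objects,
pullbacks and products, known only by universal properties, can be computed on sections.

The terminal presheaf has only ideal sections, so a section of `Ω` is true exactly when it is ideal.
Subobjects contain all ideal sections, so pointedness is no obstruction to the classical picture: a
section of `Ω` over `U` is the same thing as a sieve at `U`. Existence comes from the predicate of
`hull R → hull ⊤` at the generic section, uniqueness from uniqueness of predicates
(`sieve_surjective`, `sieve_injective`). The meet operation becomes intersection (`sieve_meet`).

A Lawvere–Tierney topology is therefore a closure operator on sieves commuting with pullback and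
intersection, and such operators correspond to Grothendieck topologies: the covering sieves are
those with maximal closure, and the closure of `R` consists of the `f` along which `R` pulls back to
a covering sieve.

For sheaves, a monic `A → B` is dense exactly when every section of `B` lies in `A` locally
(`isDense_iff`). An arrow on `A` then extends to `B` by gluing. Conversely, for covering `R` the
inclusion `hull R → hull ⊤` is dense, and extension along it is amalgamation of matching families.
-/

namespace GenPresheafCat

variable {C : Type u} {E : Type v} [GenCat C] [GenCat E] (S : GenPresheafCat C E)

/-! ### Sections, restriction and the action of arrows -/

/-- The sections of `P` over `U`. -/
abbrev Sec (P : S.Psh) (U : Flat C) : Type v := (S.sections P).obj (op U)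

variable {S}

/-- The restriction of a section along an element of the base. -/
def res {P : S.Psh} {V U : Flat C} (f : V ⟶ U) (s : S.Sec P U) : S.Sec P V :=
  (S.sections P).map f.op s

/-- The action of an arrow of generalized presheaves on sections. -/
def act {P Q : S.Psh} (g : P ⟶ Q) {U : Flat C} (s : S.Sec P U) : S.Sec Q U :=
  (S.toBipartite.fib.map g).app (op U) s

lemma res_id {P : S.Psh} {U : Flat C} (s : S.Sec P U) : res (𝟙 U) s = s := by
  simp [res]

lemma res_res {P : S.Psh} {W V U : Flat C} (g : W ⟶ V) (f : V ⟶ U) (s : S.Sec P U) :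
    res g (res f s) = res (g ≫ f) s := by
  unfold res
  rw [op_comp, Functor.map_comp]
  rfl

lemma act_res {P Q : S.Psh} (g : P ⟶ Q) {V U : Flat C} (f : V ⟶ U) (s : S.Sec P U) :
    act g (res f s) = res f (act g s) :=
  congrArg (fun k => k s) ((S.toBipartite.fib.map g).naturality f.op)

lemma act_comp {P Q R : S.Psh} (g : P ⟶ Q) (h : Q ⟶ R) {U : Flat C} (s : S.Sec P U) :
    act (g ≫ h) s = act h (act g s) := by
  unfold act
  rw [Functor.map_comp]
  rfl

lemma act_ideal {P Q : S.Psh} (g : P ⟶ Q) (U : Flat C) : act g (S.ideal P U) = S.ideal Q U :=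
  S.comp_ideal g U

lemma res_ideal (P : S.Psh) {V U : Flat C} (f : V ⟶ U) :
    res f (S.ideal P U) = S.ideal P V :=
  S.ideal_restrict P f

/-- This is the uniqueness half of maximality; the existence half is `exists_act`. -/
lemma hom_ext {P Q : S.Psh} {g h : P ⟶ Q}
    (H : ∀ (U : Flat C) (s : S.Sec P U), act g s = act h s) : g = h := by
  refine (S.exists_hom P Q (S.toBipartite.fib.map h) (S.comp_ideal h)).unique ?_ rfl
  ext U s
  exact H U.unop s

lemma exists_act {P Q : S.Psh} (φ : ∀ U : Flat C, S.Sec P U → S.Sec Q U)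
    (hφ : ∀ {V U : Flat C} (f : V ⟶ U) (s : S.Sec P U), φ V (res f s) = res f (φ U s))
    (hi : ∀ U, φ U (S.ideal P U) = S.ideal Q U) :
    ∃ g : P ⟶ Q, ∀ (U : Flat C) (s : S.Sec P U), act g s = φ U s := by
  obtain ⟨g, hg, -⟩ := S.exists_hom P Q
    { app := fun U => ↾(fun s => φ U.unop s)
      naturality := by
        intro U V f
        ext s
        exact hφ f.unop s } hi
  refine ⟨g, fun U s => ?_⟩
  unfold act
  rw [hg]
  rfl

/-- An arrow into `B` whose values lie in the image of an injective arrow `A → B` lifts to `A`. -/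
lemma exists_lift {A B W : S.Psh} (m : A ⟶ B)
    (hm : ∀ (U : Flat C) (a a' : S.Sec A U), act m a = act m a' → a = a') (g : W ⟶ B)
    (hg : ∀ (U : Flat C) (w : S.Sec W U), ∃ a : S.Sec A U, act m a = act g w) :
    ∃ h : W ⟶ A, h ≫ m = g := by
  choose φ hφ using hg
  obtain ⟨h, hh⟩ := exists_act (fun U w => φ U w)
    (fun f s => hm _ _ _ (by rw [hφ, act_res, act_res, hφ]))
    (fun U => hm _ _ _ (by rw [hφ, act_ideal, act_ideal]))
  exact ⟨h, hom_ext fun U w => by rw [act_comp, hh, hφ]⟩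

/-! ### Generalized presheaves freely generated by sieves -/

/-- The pointed profunctor obtained from a sieve by adjoining ideal sections. -/
def sieveProfunctor {U : Flat C} (R : Sieve U) : IdealProfunctor.{u, u} C where
  Fib :=
    { obj := fun V => Option {f : V.unop ⟶ U // R f}
      map := fun g => ↾(Option.map fun f => ⟨g.unop ≫ f.1, R.downward_closed f.2 _⟩)
      map_id := by
        intro V
        ext x
        rcases x with _ | ⟨f, hf⟩ <;> simp
      map_comp := by
        intro V W X g h
        ext x
        rcases x with _ | ⟨f, hf⟩ <;> simp }
  ideal _ := none
  map_ideal _ := rfl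

variable (S)

/-- A generalized presheaf realizing the sieve `R` with ideal sections adjoined. -/
noncomputable def hull {U : Flat C} (R : Sieve U) : S.Psh :=
  (S.exists_presheaf (sieveProfunctor R)).choose

/-- The sections of `hull R`. -/
noncomputable def hullEquiv {U : Flat C} (R : Sieve U) (V : Flat C) :
    S.Sec (S.hull R) V ≃ Option {f : V ⟶ U // R f} :=
  (S.exists_presheaf (sieveProfunctor R)).choose_spec.2.choose V

lemma hullEquiv_ideal {U : Flat C} (R : Sieve U) (V : Flat C) :
    S.hullEquiv R V (S.ideal _ V) = none :=
  (S.exists_presheaf (sieveProfunctor R)).choose_spec.2.choose_spec.1 V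

lemma hullEquiv_res {U : Flat C} (R : Sieve U) {W V : Flat C} (g : W ⟶ V)
    (s : S.Sec (S.hull R) V) :
    S.hullEquiv R W (res g s) = (S.hullEquiv R V s).map
      fun f => ⟨g ≫ f.1, R.downward_closed f.2 _⟩ :=
  (S.exists_presheaf (sieveProfunctor R)).choose_spec.2.choose_spec.2 W V g s

/-- The section of `hull R` given by an element of `R`. -/
noncomputable def gen {U : Flat C} (R : Sieve U) {V : Flat C} (f : V ⟶ U) (hf : R f) :
    S.Sec (S.hull R) V :=
  (S.hullEquiv R V).symm (some ⟨f, hf⟩)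

variable {S}

lemma res_gen {U : Flat C} (R : Sieve U) {W V : Flat C} (g : W ⟶ V) (f : V ⟶ U) (hf : R f) :
    res g (S.gen R f hf) = S.gen R (g ≫ f) (R.downward_closed hf g) := by
  apply (S.hullEquiv R W).injective
  rw [hullEquiv_res, gen, gen, Equiv.apply_symm_apply, Equiv.apply_symm_apply]
  rfl

lemma eq_ideal_or_gen {U : Flat C} (R : Sieve U) {V : Flat C} (s : S.Sec (S.hull R) V) :
    s = S.ideal _ V ∨ ∃ (f : V ⟶ U) (hf : R f), s = S.gen R f hf := by
  rcases h : S.hullEquiv R V s with _ | ⟨f, hf⟩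
  · exact Or.inl ((S.hullEquiv R V).injective (h.trans (S.hullEquiv_ideal R V).symm))
  · exact Or.inr ⟨f, hf, (Equiv.eq_symm_apply _).2 h⟩

/-- The adjoined point is disjoint from the sieve. Thus an ideal section, which every monic hits,
never forces an element into a sieve. -/
lemma gen_ne_ideal {U : Flat C} (R : Sieve U) {V : Flat C} (f : V ⟶ U) (hf : R f) :
    S.gen R f hf ≠ S.ideal _ V := by
  intro h
  have := congrArg (S.hullEquiv R V) h
  rw [hullEquiv_ideal, gen, Equiv.apply_symm_apply] at this
  cases this

lemma gen_injective {U : Flat C} (R : Sieve U) {V : Flat C} {f g : V ⟶ U} {hf : R f} {hg : R g}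
    (h : S.gen R f hf = S.gen R g hg) : f = g :=
  congrArg Subtype.val (Option.some.inj ((S.hullEquiv R V).symm.injective h))

/-- Arrows out of `hull R` are matching families for `R`. -/
lemma exists_hull_hom {U : Flat C} (R : Sieve U) {P : S.Psh}
    (x : ∀ (V : Flat C) (f : V ⟶ U), R f → S.Sec P V)
    (hx : ∀ {W V : Flat C} (g : W ⟶ V) (f : V ⟶ U) (hf : R f),
      x W (g ≫ f) (R.downward_closed hf g) = res g (x V f hf)) :
    ∃ k : S.hull R ⟶ P, ∀ (V : Flat C) (f : V ⟶ U) (hf : R f), act k (S.gen R f hf) = x V f hf := by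
  obtain ⟨k, hk⟩ := exists_act (P := S.hull R) (Q := P)
    (fun V s => (S.hullEquiv R V s).elim (S.ideal P V) fun f => x V f.1 f.2)
    (by
      intro W V g s
      rw [hullEquiv_res]
      rcases S.hullEquiv R V s with _ | ⟨f, hf⟩
      · exact (res_ideal P g).symm
      · exact hx g f hf)
    (by
      intro V
      rw [hullEquiv_ideal]
      rfl)
  refine ⟨k, fun V f hf => ?_⟩
  rw [hk, gen, Equiv.apply_symm_apply]
  rfl

lemma hull_hom_ext {U : Flat C} (R : Sieve U) {P : S.Psh} {k l : S.hull R ⟶ P}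
    (h : ∀ (V : Flat C) (f : V ⟶ U) (hf : R f), act k (S.gen R f hf) = act l (S.gen R f hf)) :
    k = l := by
  refine hom_ext fun V s => ?_
  rcases eq_ideal_or_gen R s with rfl | ⟨f, hf, rfl⟩
  · rw [act_ideal, act_ideal]
  · exact h V f hf

/-! ### Sections as arrows out of `hull ⊤`: the Yoneda lemma and its consequences. -/

variable (S) in
/-- The generic section over `U`. -/
noncomputable abbrev genId (U : Flat C) : S.Sec (S.hull (⊤ : Sieve U)) U :=
  S.gen ⊤ (𝟙 U) trivial

lemma gen_top {V U : Flat C} (f : V ⟶ U) (hf : (⊤ : Sieve U) f) :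
    S.gen ⊤ f hf = res f (S.genId U) := by
  rw [res_gen]
  congr 1
  exact (Category.comp_id f).symm

/-- The restrictions of `s` form a matching family for the maximal sieve. -/
lemma exists_rep {P : S.Psh} {U : Flat C} (s : S.Sec P U) :
    ∃ k : S.hull (⊤ : Sieve U) ⟶ P, act k (S.genId U) = s := by
  obtain ⟨k, hk⟩ := exists_hull_hom (S := S) (⊤ : Sieve U) (fun V f _ => res f s)
    (fun g f _ => (res_res g f s).symm)
  exact ⟨k, (hk _ _ _).trans (res_id s)⟩

lemma rep_ext {P : S.Psh} {U : Flat C} {k l : S.hull (⊤ : Sieve U) ⟶ P}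
    (h : act k (S.genId U) = act l (S.genId U)) : k = l :=
  hull_hom_ext _ fun V f hf => by rw [gen_top, act_res, act_res, h]

/-- Sections are arrows from `hull ⊤`, so `m` can be cancelled against them. -/
lemma act_injective_of_mono {A B : S.Psh} (m : A ⟶ B) [Mono m] (U : Flat C) (a a' : S.Sec A U)
    (h : act m a = act m a') : a = a' := by
  obtain ⟨k, rfl⟩ := exists_rep a
  obtain ⟨l, rfl⟩ := exists_rep a'
  rw [(cancel_mono m).1 (rep_ext (k := k ≫ m) (l := l ≫ m) (by rw [act_comp, act_comp, h]))]

lemma mono_of_act_injective {A B : S.Psh} (m : A ⟶ B)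
    (hm : ∀ (U : Flat C) (a a' : S.Sec A U), act m a = act m a' → a = a') : Mono m where
  right_cancellation g h e := hom_ext fun U s => hm _ _ _ (by rw [← act_comp, e, act_comp])

lemma sec_eq_ideal_of_isTerminal {T : S.Psh} (hT : IsTerminal T) {U : Flat C} (t : S.Sec T U) :
    t = S.ideal T U := by
  obtain ⟨k, hk⟩ := exists_rep t
  obtain ⟨l, hl⟩ := exists_rep (S.ideal T U)
  rw [← hk, ← hl, hT.hom_ext k l]

/-- The inclusion of a sieve into the representable profunctor. -/
lemma exists_hull_incl {U : Flat C} (R : Sieve U) :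
    ∃ m : S.hull R ⟶ S.hull (⊤ : Sieve U), Mono m ∧
      ∀ (V : Flat C) (f : V ⟶ U) (hf : R f), act m (S.gen R f hf) = S.gen ⊤ f trivial := by
  obtain ⟨m, hm⟩ := exists_hull_hom (S := S) R (fun V f _ => S.gen (⊤ : Sieve U) f trivial)
    (fun g f _ => (res_gen (⊤ : Sieve U) g f trivial).symm)
  refine ⟨m, mono_of_act_injective m fun V a a' h => ?_, hm⟩
  rcases eq_ideal_or_gen R a with rfl | ⟨f, hf, rfl⟩ <;>
    rcases eq_ideal_or_gen R a' with rfl | ⟨f', hf', rfl⟩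
  · rfl
  · rw [act_ideal, hm] at h
    exact absurd h.symm (gen_ne_ideal _ _ _)
  · rw [act_ideal, hm] at h
    exact absurd h (gen_ne_ideal _ _ _)
  · rw [hm, hm] at h
    obtain rfl := gen_injective _ h
    rfl

/-! ### Pullbacks of a point -/

lemma isPullback_of_act {A B Ω T : S.Psh} (hT : IsTerminal T) (t : T ⟶ Ω) (m : A ⟶ B)
    (hm : ∀ (U : Flat C) (a a' : S.Sec A U), act m a = act m a' → a = a') (p : B ⟶ Ω)
    (h : ∀ (U : Flat C) (b : S.Sec B U), act p b = S.ideal Ω U ↔ ∃ a, act m a = b) :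
    IsPullback m (hT.from A) p t := by
  have : Mono m := mono_of_act_injective m hm
  have key (c : PullbackCone p t) : ∃ k : c.pt ⟶ A, k ≫ m = c.fst := by
    refine exists_lift m hm c.fst fun U w => (h U _).1 ?_
    rw [← act_comp, c.condition, act_comp, sec_eq_ideal_of_isTerminal hT (act c.snd w), act_ideal]
  refine ⟨⟨hom_ext fun U a => ?_⟩, ⟨PullbackCone.IsLimit.mk _ (fun c => (key c).choose)
    (fun c => (key c).choose_spec) (fun c => hT.hom_ext _ _) fun c k hk _ => ?_⟩⟩
  · rw [act_comp, act_comp, (h U _).2 ⟨a, rfl⟩, sec_eq_ideal_of_isTerminal hT (act _ a), act_ideal]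
  · rw [← cancel_mono m, hk, (key c).choose_spec]

/-- Converse to `isPullback_of_act`: the universal property is tested on the arrow representing `b`.
-/
lemma act_eq_ideal_iff {A B Ω T : S.Psh} (hT : IsTerminal T) (t : T ⟶ Ω) (m : A ⟶ B)
    (p : B ⟶ Ω) (h : IsPullback m (hT.from A) p t) {U : Flat C} (b : S.Sec B U) :
    act p b = S.ideal Ω U ↔ ∃ a, act m a = b := by
  constructor
  · intro hb
    obtain ⟨k, rfl⟩ := exists_rep b
    refine ⟨act (h.lift k (hT.from _) (rep_ext ?_)) (S.genId U), ?_⟩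
    · rw [act_comp, act_comp, hb, sec_eq_ideal_of_isTerminal hT (act _ _), act_ideal]
    · rw [← act_comp, h.lift_fst]
  · rintro ⟨a, rfl⟩
    rw [← act_comp, h.w, act_comp, sec_eq_ideal_of_isTerminal hT (act _ _), act_ideal]

end GenPresheafCat

namespace GenPresheafCat

variable {C : Type u} {E : Type v} [GenCat C] [GenCat E]

namespace SubobjectClassifier

variable {S : GenPresheafCat C E} (K : S.SubobjectClassifier)

/-! ### Sections of the subobject classifier are sieves -/

/-- Truth is idealness: the only section of the terminal object is ideal, and `tru` preserves it. -/
lemma sieve_apply {U V : Flat C} (θ : S.Sec K.Ω U) (f : V ⟶ U) :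
    K.sieve θ f ↔ res f θ = S.ideal K.Ω V := by
  constructor
  · rintro ⟨t, ht⟩
    refine ht.symm.trans ?_
    rw [sec_eq_ideal_of_isTerminal K.isTerminal t]
    exact act_ideal K.tru V
  · intro h
    exact ⟨S.ideal K.one V, (act_ideal K.tru V).trans h.symm⟩

lemma sieve_res {U V : Flat C} (θ : S.Sec K.Ω U) (f : V ⟶ U) :
    K.sieve (res f θ) = (K.sieve θ).pullback f := by
  ext W g
  rw [Sieve.pullback_apply, sieve_apply, sieve_apply, res_res]

lemma sieve_eq_top_iff {U : Flat C} (θ : S.Sec K.Ω U) :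
    K.sieve θ = ⊤ ↔ θ = S.ideal K.Ω U := by
  rw [← Sieve.id_mem_iff_eq_top]
  exact (K.sieve_apply θ (𝟙 U)).trans (by rw [res_id])

lemma sieve_pred {A B : S.Psh} (m : A ⟶ B) [Mono m] {U V : Flat C} (b : S.Sec B U) (f : V ⟶ U) :
    K.sieve (act (K.pred m) b) f ↔ ∃ a, act m a = res f b := by
  rw [sieve_apply, ← act_res]
  exact act_eq_ideal_iff K.isTerminal K.tru m _ (K.isPullback m) _

/-- The predicate of `hull R → hull ⊤` at the generic section names `R`, since the generic section
restricts along `f` into `hull R` exactly when `f` is in `R`. -/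
lemma sieve_surjective {U : Flat C} (R : Sieve U) : ∃ θ : S.Sec K.Ω U, K.sieve θ = R := by
  obtain ⟨m, _, hm⟩ := exists_hull_incl (S := S) R
  refine ⟨act (K.pred m) (S.genId U), ?_⟩
  ext V f
  rw [sieve_pred]
  constructor
  · rintro ⟨a, ha⟩
    rw [← gen_top f trivial] at ha
    rcases eq_ideal_or_gen R a with rfl | ⟨g, hg, rfl⟩
    · rw [act_ideal] at ha
      exact absurd ha.symm (gen_ne_ideal _ _ _)
    · rw [hm] at ha
      exact gen_injective _ ha ▸ hg
  · intro hf
    exact ⟨_, (hm V f hf).trans (gen_top f trivial)⟩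

lemma eq_pred_of_forall_iff {A B : S.Psh} (m : A ⟶ B) [Mono m] (p : B ⟶ K.Ω)
    (h : ∀ (U : Flat C) (b : S.Sec B U), act p b = S.ideal K.Ω U ↔ ∃ a, act m a = b) :
    p = K.pred m :=
  K.pred_unique m p (isPullback_of_act K.isTerminal K.tru m (act_injective_of_mono m) p h)

/-- The arrows representing `θ` and `θ'` both classify the inclusion of the hull of their common
sieve, so they agree by uniqueness of predicates. -/
lemma sieve_injective {U : Flat C} {θ θ' : S.Sec K.Ω U} (h : K.sieve θ = K.sieve θ') :
    θ = θ' := by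
  obtain ⟨m, _, hm⟩ := exists_hull_incl (S := S) (K.sieve θ)
  have key (η : S.Sec K.Ω U) (hη : K.sieve θ = K.sieve η) (p : S.hull (⊤ : Sieve U) ⟶ K.Ω)
      (hp : act p (S.genId U) = η) : p = K.pred m := by
    refine K.eq_pred_of_forall_iff m p fun V b => ?_
    rcases eq_ideal_or_gen _ b with rfl | ⟨f, hf, rfl⟩
    · exact ⟨fun _ => ⟨_, act_ideal m V⟩, fun _ => act_ideal p V⟩
    · rw [gen_top, act_res, hp, ← sieve_apply, ← hη, ← gen_top f trivial]
      constructor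
      · intro hf
        exact ⟨_, hm V f hf⟩
      · rintro ⟨a, ha⟩
        rcases eq_ideal_or_gen _ a with rfl | ⟨g, hg, rfl⟩
        · rw [act_ideal] at ha
          exact absurd ha.symm (gen_ne_ideal _ _ _)
        · rw [hm] at ha
          exact gen_injective _ ha ▸ hg
  obtain ⟨p, hp⟩ := exists_rep θ
  obtain ⟨q, hq⟩ := exists_rep θ'
  rw [← hp, ← hq, key θ rfl p hp, key θ' h q hq]

/-- The section of `Ω` naming a sieve. -/
noncomputable def name {U : Flat C} (R : Sieve U) : S.Sec K.Ω U := (K.sieve_surjective R).choose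

@[simp]
lemma sieve_name {U : Flat C} (R : Sieve U) : K.sieve (K.name R) = R :=
  (K.sieve_surjective R).choose_spec

@[simp]
lemma name_sieve {U : Flat C} (θ : S.Sec K.Ω U) : K.name (K.sieve θ) = θ :=
  K.sieve_injective (K.sieve_name _)

lemma name_pullback {U V : Flat C} (f : V ⟶ U) (R : Sieve U) :
    K.name (R.pullback f) = res f (K.name R) :=
  K.sieve_injective (by rw [sieve_name, sieve_res, sieve_name])

/-! ### The meet operation -/

lemma pair_fst {A : S.Psh} (f g : A ⟶ K.Ω) : K.pair f g ≫ K.fst = f :=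
  K.isProduct.fac (BinaryFan.mk f g) ⟨WalkingPair.left⟩

lemma pair_snd {A : S.Psh} (f g : A ⟶ K.Ω) : K.pair f g ≫ K.snd = g :=
  K.isProduct.fac (BinaryFan.mk f g) ⟨WalkingPair.right⟩

/-- Together with `exists_sec_prod`, this transfers the universal property of the product to
sections by representing them. -/
lemma sec_prod_ext {U : Flat C} {x y : S.Sec K.ΩΩ U} (h₁ : act K.fst x = act K.fst y)
    (h₂ : act K.snd x = act K.snd y) : x = y := by
  obtain ⟨p, rfl⟩ := exists_rep x
  obtain ⟨q, rfl⟩ := exists_rep y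
  rw [BinaryFan.IsLimit.hom_ext K.isProduct
    (rep_ext (k := p ≫ K.fst) (l := q ≫ K.fst) (by rw [act_comp, act_comp, h₁]))
    (rep_ext (k := p ≫ K.snd) (l := q ≫ K.snd) (by rw [act_comp, act_comp, h₂]))]

lemma exists_sec_prod {U : Flat C} (θ θ' : S.Sec K.Ω U) :
    ∃ x : S.Sec K.ΩΩ U, act K.fst x = θ ∧ act K.snd x = θ' := by
  obtain ⟨p, rfl⟩ := exists_rep θ
  obtain ⟨q, rfl⟩ := exists_rep θ'
  exact ⟨act (K.pair p q) (S.genId U), by rw [← act_comp, pair_fst], by rw [← act_comp, pair_snd]⟩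

/-- The image of `⟨true, true⟩` consists of the ideal sections of the product, which are those with
both components ideal. -/
lemma sieve_meet {U : Flat C} (x : S.Sec K.ΩΩ U) :
    K.sieve (act K.meet x) = K.sieve (act K.fst x) ⊓ K.sieve (act K.snd x) := by
  let _ : Mono (K.pair K.tru K.tru) := K.isTerminal.mono_from _
  ext V f
  rw [Sieve.inter_apply, sieve_apply, sieve_apply, sieve_apply, ← act_res, ← act_res, ← act_res]
  refine (act_eq_ideal_iff K.isTerminal K.tru (K.pair K.tru K.tru) _
    (K.isPullback (K.pair K.tru K.tru)) _).trans ?_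
  constructor
  · rintro ⟨a, ha⟩
    rw [← ha, sec_eq_ideal_of_isTerminal K.isTerminal a, act_ideal]
    exact ⟨act_ideal _ _, act_ideal _ _⟩
  · rintro ⟨h₁, h₂⟩
    refine ⟨S.ideal _ V, ?_⟩
    rw [act_ideal]
    exact K.sec_prod_ext (by rw [h₁, act_ideal]) (by rw [h₂, act_ideal])

variable {K}

/-! ### Lawvere–Tierney topologies as closure operators on sieves -/

namespace LTTopology

@[ext]
lemma ext' {L L' : K.LTTopology} (h : L.j = L'.j) : L = L' := by
  cases L; cases L'; cases h; rfl

variable (L : K.LTTopology)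

/-- The operation on sieves given by a Lawvere–Tierney topology. -/
noncomputable def cl {U : Flat C} (R : Sieve U) : Sieve U := K.sieve (act L.j (K.name R))

lemma cl_sieve {U : Flat C} (θ : S.Sec K.Ω U) : L.cl (K.sieve θ) = K.sieve (act L.j θ) := by
  rw [cl, name_sieve]

lemma cl_pullback {U V : Flat C} (f : V ⟶ U) (R : Sieve U) :
    L.cl (R.pullback f) = (L.cl R).pullback f := by
  rw [cl, name_pullback, act_res, sieve_res, cl]

/-- The maximal sieve is named by the ideal section, which every arrow preserves. -/
lemma cl_top {U : Flat C} : L.cl (⊤ : Sieve U) = ⊤ := by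
  rw [cl, sieve_eq_top_iff, (K.sieve_eq_top_iff (K.name ⊤)).1 (K.sieve_name ⊤), act_ideal]

lemma cl_cl {U : Flat C} (R : Sieve U) : L.cl (L.cl R) = L.cl R := by
  rw [cl, cl, name_sieve, ← act_comp, L.j_j]

/-- This is the axiom `meet_j` evaluated at the section of `Ω ∧ Ω` whose components name the two
sieves. -/
lemma cl_inf {U : Flat C} (R R' : Sieve U) : L.cl (R ⊓ R') = L.cl R ⊓ L.cl R' := by
  obtain ⟨x, h₁, h₂⟩ := K.exists_sec_prod (K.name R) (K.name R')
  have h : K.sieve (act K.meet x) = R ⊓ R' := by rw [sieve_meet, h₁, h₂, sieve_name, sieve_name]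
  rw [← h, cl_sieve, ← act_comp, L.meet_j, act_comp, sieve_meet, ← act_comp, ← act_comp, pair_fst,
    pair_snd, act_comp, act_comp, h₁, h₂, cl, cl]

/-- An element belongs to a sieve iff the pullback along it is maximal, and closure respects
pullbacks and the maximal sieve. -/
lemma le_cl {U : Flat C} (R : Sieve U) : R ≤ L.cl R := by
  intro V f hf
  rw [Sieve.mem_iff_pullback_eq_top] at hf ⊢
  rw [← cl_pullback, hf, cl_top]

/-- The closure operator on sieves given by a Lawvere–Tierney topology. -/
noncomputable def closureOperator (U : Flat C) : ClosureOperator (Sieve U) :=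
  -- Monotonicity follows from preservation of intersections, as inclusion means `R ⊓ R' = R`.
  .mk' L.cl (fun R R' h => inf_eq_left.1 (by rw [← cl_inf, inf_eq_left.2 h])) L.le_cl
    fun R => (L.cl_cl R).le

/-- The Grothendieck topology given by a Lawvere–Tierney topology. -/
noncomputable def topology : GrothendieckTopology (Flat C) :=
  topologyOfClosureOperator L.closureOperator fun _ _ => L.cl_pullback

lemma mem_topology {U : Flat C} (R : Sieve U) : R ∈ L.topology U ↔ L.cl R = ⊤ := Iff.rfl

lemma close_topology {U : Flat C} (R : Sieve U) : L.topology.close R = L.cl R :=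
  topologyOfClosureOperator_close L.closureOperator (fun _ _ => L.cl_pullback) U R

end LTTopology

/-! ### From Grothendieck topologies to Lawvere–Tierney topologies, and the bijection. -/

variable (K) in
lemma exists_close (J : GrothendieckTopology (Flat C)) :
    ∃ j : K.Ω ⟶ K.Ω, ∀ (U : Flat C) (θ : S.Sec K.Ω U), K.sieve (act j θ) = J.close (K.sieve θ) := by
  obtain ⟨j, hj⟩ := exists_act (P := K.Ω) (Q := K.Ω) (fun U θ => K.name (J.close (K.sieve θ)))
    (fun f θ => by rw [sieve_res, J.pullback_close, name_pullback])
    (fun U => (K.sieve_eq_top_iff _).1 (by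
      rw [sieve_name, (K.sieve_eq_top_iff _).2 rfl]
      exact top_unique (J.le_close ⊤)))
  exact ⟨j, fun U θ => by rw [hj, sieve_name]⟩

/-- The Lawvere–Tierney topology given by a Grothendieck topology. -/
noncomputable def ltTopology (K : S.SubobjectClassifier) (J : GrothendieckTopology (Flat C)) :
    K.LTTopology where
  j := (K.exists_close J).choose
  tru_j := hom_ext fun U t => by
    rw [act_comp, sec_eq_ideal_of_isTerminal K.isTerminal t, act_ideal, act_ideal]
  j_j := hom_ext fun U θ => K.sieve_injective (by
    rw [act_comp, (K.exists_close J).choose_spec, (K.exists_close J).choose_spec, J.close_close])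
  meet_j := hom_ext fun U x => K.sieve_injective (by
    rw [act_comp, (K.exists_close J).choose_spec, sieve_meet, act_comp, sieve_meet, ← act_comp,
      ← act_comp, pair_fst, pair_snd, act_comp, act_comp, (K.exists_close J).choose_spec,
      (K.exists_close J).choose_spec]
    -- Membership of `f` in a closure means that the pullback along `f` covers, and an intersection
    -- of two sieves covers iff both do.
    ext V f
    change Sieve.pullback f (_ ⊓ _) ∈ J V ↔ Sieve.pullback f _ ∈ J V ∧ Sieve.pullback f _ ∈ J V
    rw [Sieve.pullback_inter, J.intersection_covering_iff])

lemma cl_ltTopology (J : GrothendieckTopology (Flat C)) {U : Flat C} (R : Sieve U) :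
    (K.ltTopology J).cl R = J.close R := by
  obtain ⟨θ, rfl⟩ := K.sieve_surjective R
  rw [LTTopology.cl_sieve]
  exact (K.exists_close J).choose_spec U θ

/-- Grothendieck topologies on the base are Lawvere–Tierney topologies. -/
noncomputable def topologyEquiv (K : S.SubobjectClassifier) :
    GrothendieckTopology (Flat C) ≃ K.LTTopology where
  toFun := K.ltTopology
  invFun := LTTopology.topology
  -- A sieve covers iff its closure is maximal, so the closure determines the topology.
  left_inv J := by
    ext U R
    rw [LTTopology.mem_topology, cl_ltTopology, J.close_eq_top_iff_mem]
  right_inv L := LTTopology.ext' (hom_ext fun U θ => K.sieve_injective (by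
    rw [← LTTopology.cl_sieve, ← LTTopology.cl_sieve, cl_ltTopology, LTTopology.close_topology]))

/-! ### Sheaves -/

namespace LTTopology

variable (L : K.LTTopology)

/-- Density says that every section of `B` lies in `A` locally: the closure of its sieve is maximal,
that is, the sieve covers. -/
lemma isDense_iff {A B : S.Psh} (m : A ⟶ B) [Mono m] :
    L.IsDense m ↔ ∀ (U : Flat C) (b : S.Sec B U), K.sieve (act (K.pred m) b) ∈ L.topology U := by
  have key (U : Flat C) (b : S.Sec B U) : act (K.truAt B) b = S.ideal K.Ω U := by
    rw [truAt, act_comp, sec_eq_ideal_of_isTerminal K.isTerminal (act _ b), act_ideal]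
  simp only [mem_topology, cl_sieve, sieve_eq_top_iff, ← act_comp]
  constructor
  · intro h U b
    rw [show K.pred m ≫ L.j = K.truAt B from h, key]
  · intro h
    exact hom_ext fun U b => by rw [h, key]

/-- A section `b` of `B` lifts to `A` along a covering sieve. The images under `f` of these lifts
match, and their amalgamation is the forced value at `b`. -/
lemma isSheaf_of_isSheaf {P : S.Psh} (h : S.IsSheaf L.topology P) : L.IsSheaf P := by
  intro A B m _ hm f
  rw [isDense_iff] at hm
  have lift {U : Flat C} (b : S.Sec B U) {V : Flat C} (g : V ⟶ U)
      (hg : K.sieve (act (K.pred m) b) g) : ∃ a, act m a = res g b := (K.sieve_pred m b g).1 hg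
  choose a ha using @lift
  have amalg {U : Flat C} (b : S.Sec B U) : ∃! s : S.Sec P U,
      ∀ (V : Flat C) (g : V ⟶ U) (hg : K.sieve (act (K.pred m) b) g),
        res g s = act f (a b g hg) := by
    refine h _ (hm U b) (fun V g hg => act f (a b g hg)) ?_
    refine (Presieve.compatible_iff_sieveCompatible _).2 fun V W g k hg => ?_
    refine Eq.trans ?_ (act_res f k _)
    -- Lifts were chosen independently, but injectivity of `m` makes them compatible with
    -- restriction.
    exact congrArg _ (act_injective_of_mono m _ _ _ (by rw [ha, act_res, ha, res_res]))
  choose φ hφ hu using @amalg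
  -- `eq_of` and `val` characterize the amalgamation by arbitrary lifts `c` in place of the chosen
  -- ones.
  have eq_of (U : Flat C) (b : S.Sec B U) (s : S.Sec P U)
      (hs : ∀ (V : Flat C) (g : V ⟶ U) (c : S.Sec A V), act m c = res g b →
        res g s = act f c) : φ b = s :=
    (hu b s fun V g hg => hs V g _ (ha b g hg)).symm
  have val {U : Flat C} (b : S.Sec B U) {V : Flat C} (g : V ⟶ U) (c : S.Sec A V)
      (hc : act m c = res g b) : res g (φ b) = act f c := by
    have hg : K.sieve (act (K.pred m) b) g := (K.sieve_pred m b g).2 ⟨c, hc⟩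
    rw [hφ b V g hg, act_injective_of_mono m _ _ _ ((ha b g hg).trans hc.symm)]
  obtain ⟨k, hk⟩ := exists_act (P := B) (Q := P) (fun U b => φ b)
    (fun g b => eq_of _ _ _ fun V g' c hc => by
      rw [res_res]
      exact val b _ c (by rw [hc, res_res]))
    -- By injectivity of `m`, a lift of an ideal section is ideal, so the ideal section of `P` is
    -- the amalgamation.
    (fun U => eq_of _ _ _ fun V g c hc => by
      rw [res_ideal] at hc ⊢
      rw [act_injective_of_mono m _ c (S.ideal A V) (by rw [hc, act_ideal]), act_ideal])
  refine ⟨k, hom_ext fun U c => ?_, fun l hl => hom_ext fun U b => ?_⟩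
  · rw [act_comp, hk]
    simpa only [res_id] using val (act m c) (𝟙 U) c (res_id _).symm
  · rw [hk]
    refine (eq_of _ _ _ fun V g c hc => ?_).symm
    rw [← act_res, ← hc, ← act_comp, hl]

/-- A matching family for `R` is an arrow from `hull R`, an amalgamation is an extension to `hull
⊤`, and the inclusion is dense because `R` covers. -/
lemma isSheaf_topology {P : S.Psh} (h : L.IsSheaf P) : S.IsSheaf L.topology P := by
  intro U R hR x hx
  rw [Presieve.compatible_iff_sieveCompatible] at hx
  obtain ⟨m, _, hm⟩ := exists_hull_incl (S := S) R
  have dense : L.IsDense m := by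
    rw [isDense_iff]
    intro V b
    rcases eq_ideal_or_gen _ b with rfl | ⟨f, hf, rfl⟩
    · rw [act_ideal, (K.sieve_eq_top_iff _).2 rfl]
      exact L.topology.top_mem V
    -- The section given by `f` restricts into `hull R` along every element of the pullback of `R`
    -- along `f`.
    · refine L.topology.superset_covering ?_ (L.topology.pullback_stable f hR)
      intro W g hg
      rw [sieve_pred]
      exact ⟨_, (hm W (g ≫ f) hg).trans (res_gen _ g f trivial).symm⟩
  obtain ⟨f, hf⟩ := exists_hull_hom R (fun V g hg => x g hg) (fun g f hf => hx f g hf)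
  obtain ⟨k, hk, hu⟩ := h m dense f
  refine ⟨act k (S.genId U), fun V g hg => ?_, fun s hs => ?_⟩
  · change res g (act k (S.genId U)) = _
    rw [← act_res, ← gen_top g trivial, ← hm V g hg, ← act_comp, hk, hf]
  · obtain ⟨l, rfl⟩ := exists_rep s
    rw [hu l (hull_hom_ext R fun V g hg => ?_)]
    rw [act_comp, hm, gen_top, act_res, hf]
    exact hs g hg

lemma isSheaf_topology_iff (P : S.Psh) : S.IsSheaf L.topology P ↔ L.IsSheaf P :=
  ⟨L.isSheaf_of_isSheaf, L.isSheaf_topology⟩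

end LTTopology

end SubobjectClassifier

/-! ### Existence of the subobject classifier -/

variable (C) in
/-- The one-point profunctor. -/
def pointProfunctor : IdealProfunctor.{u, u} C where
  Fib := (Functor.const _).obj PUnit
  ideal _ := PUnit.unit
  map_ideal _ := rfl

variable (C) in
/-- The profunctor of sieves, with the maximal sieves as ideal sections. -/
def sievesProfunctor : IdealProfunctor.{u, u} C where
  Fib := Functor.sieves (Flat C)
  ideal _ := (⊤ : Sieve _)
  map_ideal _ := Sieve.pullback_top

variable (C) in
/-- The profunctor of pairs of sieves. -/
def sievePairsProfunctor : IdealProfunctor.{u, u} C where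
  Fib :=
    { obj := fun U => Sieve U.unop × Sieve U.unop
      map := fun f => ↾fun R => (R.1.pullback f.unop, R.2.pullback f.unop)
      map_id := by
        intro U
        ext R <;> simp
      map_comp := by
        intro U V W f g
        ext R <;> simp [Sieve.pullback_comp] }
  ideal _ := (⊤, ⊤)
  map_ideal _ := Prod.ext Sieve.pullback_top Sieve.pullback_top

/-- Maximality realizes the one-point, sieve and sieve-pair profunctors; the classical formulas on
sections then define the structure maps. Truth is the maximal sieve, which is why it serves as the
ideal section. -/
theorem nonempty_subobjectClassifier (S : GenPresheafCat C E) :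
    Nonempty S.SubobjectClassifier := by
  obtain ⟨one, h_one, e₁, -, -⟩ := S.exists_presheaf (pointProfunctor C)
  obtain ⟨Ω, hΩ, e, e_ideal, e_res⟩ := S.exists_presheaf (sievesProfunctor C)
  obtain ⟨ΩΩ, -, e₂, e₂_ideal, e₂_res⟩ := S.exists_presheaf (sievePairsProfunctor C)
  change ∀ U, S.Sec one U ≃ PUnit at e₁
  change ∀ U, S.Sec Ω U ≃ Sieve U at e
  change ∀ U, S.Sec ΩΩ U ≃ Sieve U × Sieve U at e₂
  change ∀ U, e U (S.ideal Ω U) = ⊤ at e_ideal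
  change ∀ U, e₂ U (S.ideal ΩΩ U) = (⊤, ⊤) at e₂_ideal
  change ∀ (V U : Flat C) (f : V ⟶ U) (s : S.Sec Ω U), e V (res f s) = (e U s).pullback f at e_res
  change ∀ (V U : Flat C) (f : V ⟶ U) (s : S.Sec ΩΩ U),
    e₂ V (res f s) = ((e₂ U s).1.pullback f, (e₂ U s).2.pullback f) at e₂_res
  have one_eq (U : Flat C) (s t : S.Sec one U) : s = t := (e₁ U).injective rfl
  have to_one (P : S.Psh) : ∃ g : P ⟶ one, ∀ g' : P ⟶ one, g' = g := by
    obtain ⟨g, -⟩ := exists_act (P := P) (Q := one) (fun U _ => S.ideal one U)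
      (fun f _ => (res_ideal one f).symm) fun _ => rfl
    exact ⟨g, fun g' => hom_ext fun U s => one_eq _ _ _⟩
  choose t ht using to_one
  have hT : IsTerminal one := IsTerminal.ofUniqueHom t ht
  obtain ⟨tru, -⟩ := exists_act (P := one) (Q := Ω) (fun U _ => S.ideal Ω U)
    (fun f _ => (res_ideal Ω f).symm) fun _ => rfl
  have eq_ideal_iff (U : Flat C) (θ : S.Sec Ω U) : θ = S.ideal Ω U ↔ e U θ (𝟙 U) := by
    rw [Sieve.id_mem_iff_eq_top, ← e_ideal, (e U).injective.eq_iff]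
  have exists_pred {A B : S.Psh} (m : A ⟶ B) : ∃ p : B ⟶ Ω, ∀ (U : Flat C) (b : S.Sec B U)
      (V : Flat C) (f : V ⟶ U), e U (act p b) f ↔ ∃ a, act m a = res f b := by
    obtain ⟨p, hp⟩ := exists_act (P := B) (Q := Ω)
      (fun U b => (e U).symm
        { arrows := fun V f => ∃ a, act m a = res f b
          downward_closed := by
            rintro V W f ⟨a, ha⟩ g
            exact ⟨res g a, by rw [act_res, ha, res_res]⟩ })
      (fun f b => (e _).injective (by
        rw [e_res, Equiv.apply_symm_apply, Equiv.apply_symm_apply]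
        ext W g
        change (∃ a, act m a = res g (res f b)) ↔ ∃ a, act m a = res (g ≫ f) b
        rw [res_res]))
      -- Ideal sections of `B` and all their restrictions are images of ideal sections of `A`, so
      -- their sieve is maximal.
      (fun U => by
        rw [Equiv.symm_apply_eq, e_ideal]
        exact top_unique fun V f _ => ⟨S.ideal A V, by rw [act_ideal, res_ideal]⟩)
    refine ⟨p, fun U b V f => ?_⟩
    rw [hp, Equiv.apply_symm_apply]
  choose pred hpred using @exists_pred
  obtain ⟨fst, hfst⟩ := exists_act (P := ΩΩ) (Q := Ω) (fun U x => (e U).symm (e₂ U x).1)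
    (fun f x => (e _).injective (by
      rw [e_res, Equiv.apply_symm_apply, Equiv.apply_symm_apply, e₂_res]))
    (fun U => by rw [Equiv.symm_apply_eq, e_ideal, e₂_ideal])
  obtain ⟨snd, hsnd⟩ := exists_act (P := ΩΩ) (Q := Ω) (fun U x => (e U).symm (e₂ U x).2)
    (fun f x => (e _).injective (by
      rw [e_res, Equiv.apply_symm_apply, Equiv.apply_symm_apply, e₂_res]))
    (fun U => by rw [Equiv.symm_apply_eq, e_ideal, e₂_ideal])
  have exists_pair {A : S.Psh} (f g : A ⟶ Ω) : ∃ k : A ⟶ ΩΩ, ∀ (U : Flat C) (a : S.Sec A U),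
      act k a = (e₂ U).symm (e U (act f a), e U (act g a)) :=
    exists_act (P := A) (Q := ΩΩ) (fun U a => (e₂ U).symm (e U (act f a), e U (act g a)))
      (fun f a => (e₂ _).injective (by
        rw [e₂_res, Equiv.apply_symm_apply, Equiv.apply_symm_apply, act_res, act_res, e_res, e_res]))
      (fun U => by rw [Equiv.symm_apply_eq, act_ideal, act_ideal, e₂_ideal, e_ideal])
  choose pair hpair using @exists_pair
  have pair_fst {A : S.Psh} (f g : A ⟶ Ω) : pair f g ≫ fst = f := hom_ext fun U a => by
    rw [act_comp, hpair, hfst, Equiv.apply_symm_apply, Equiv.symm_apply_apply]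
  have pair_snd {A : S.Psh} (f g : A ⟶ Ω) : pair f g ≫ snd = g := hom_ext fun U a => by
    rw [act_comp, hpair, hsnd, Equiv.apply_symm_apply, Equiv.symm_apply_apply]
  have pair_uniq {A : S.Psh} (f g : A ⟶ Ω) (k : A ⟶ ΩΩ) (h₁ : k ≫ fst = f) (h₂ : k ≫ snd = g) :
      k = pair f g := hom_ext fun U a => by
    rw [hpair, Equiv.eq_symm_apply, ← h₁, ← h₂, act_comp, act_comp, hfst, hsnd,
      Equiv.apply_symm_apply, Equiv.apply_symm_apply]
  exact ⟨{
    one := one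
    one_isObject := h_one
    isTerminal := hT
    Ω := Ω
    Ω_isObject := hΩ
    tru := tru
    pred := fun m _ => pred m
    isPullback := fun m _ => isPullback_of_act hT tru m (act_injective_of_mono m) _ fun U b => by
      rw [eq_ideal_iff, hpred, res_id]
    pred_unique := fun m _ p hp => hom_ext fun U b => (e U).injective (by
      ext V f
      -- The pullback property determines which restrictions of `b` the predicate `p` sends to the
      -- ideal section, and these are the members of its sieve.
      rw [hpred, ← act_eq_ideal_iff hT tru m p hp, act_res, eq_ideal_iff, e_res,
        Sieve.pullback_apply, Category.id_comp])
    ΩΩ := ΩΩ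
    fst := fst
    snd := snd
    isProduct := BinaryFan.IsLimit.mk _ pair pair_fst pair_snd pair_uniq }⟩

end GenPresheafCat

/-! ### The main theorem. -/

theorem mainTheorem4 {C : Type u} {E : Type v} [GenCat C] [GenCat E] (S : GenPresheafCat C E) :
    Nonempty S.SubobjectClassifier ∧
    ∀ K : S.SubobjectClassifier,
      ∃ Φ : GrothendieckTopology (Flat C) ≃ K.LTTopology,
        (∀ (J : GrothendieckTopology (Flat C)) (U : Flat C) (θ : (S.sections K.Ω).obj (op U)),
          ∀ (V : Flat C) (f : V ⟶ U),
            K.sieve ((S.toBipartite.fib.map (Φ J).j).app (op U) θ) f ↔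
              (K.sieve θ).pullback f ∈ J V) ∧
        (∀ (L : K.LTTopology) (U : Flat C) (R : Sieve U),
          R ∈ Φ.symm L U ↔ ∃ θ : (S.sections K.Ω).obj (op U),
            K.sieve θ = R ∧ K.sieve ((S.toBipartite.fib.map L.j).app (op U) θ) = ⊤) ∧
        (∀ (J : GrothendieckTopology (Flat C)) (P : S.Psh),
          S.IsSheaf J P ↔ (Φ J).IsSheaf P) ∧
        ∀ (L : K.LTTopology) (P : S.Psh),
          S.IsSheaf (Φ.symm L) P ↔ L.IsSheaf P := by
  refine ⟨S.nonempty_subobjectClassifier, fun K => ⟨K.topologyEquiv, ?_, ?_, ?_, ?_⟩⟩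
  · intro J U θ V f
    have h := ((K.topologyEquiv J).cl_sieve θ).symm.trans
      (GenPresheafCat.SubobjectClassifier.cl_ltTopology J (K.sieve θ))
    -- By definition, `f` lies in `J.close` of a sieve iff the pullback along `f` covers.
    exact iff_of_eq (congrArg (fun R : Sieve U => R f) h)
  · intro L U R
    constructor
    · intro h
      exact ⟨K.name R, K.sieve_name R, h⟩
    · rintro ⟨θ, rfl, h⟩
      exact (L.cl_sieve θ).trans h
  · intro J P
    have h := (K.topologyEquiv J).isSheaf_topology_iff P
    rwa [show (K.topologyEquiv J).topology = J from K.topologyEquiv.symm_apply_apply J] at h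
  · intro L P
    exact L.isSheaf_topology_iff P
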